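/- Let $k\ge 3$ and $n\ge k$ be integers. For an array $\mathcal T=(t_{i_1\ldots i_k})_{i_1,\ldots,i_k\in[n]}$ (a tensor of order $k$ and dimension $n$) and $\mathbf x\in\mathbb C^n$, let $\mathcal T\mathbf x^{k-1}\in\mathbb C^n$ be the vector with coordinates $(\mathcal T\mathbf x^{k-1})_i=\sum_{i_2,\ldots,i_k\in[n]}t_{ii_2\ldots i_k}x_{i_2}\cdots x_{i_k}$, and let $\mathcal I$ be the identity tensor (entry $1$ if $i_1=\cdots=i_k$, and $0$ otherwise). The determinant $\mathrm{Det}$ is the resultant of the system $\mathcal T\mathbf x^{k-1}=0$, i.e. the unique irreducible complex polynomial in the entries of $\mathcal T$ that vanishes exactly at the complex tensors for which $\mathcal T\mathbf x^{k-1}=0$ has a solution $\mathbf x\in\mathbb C^n\setminus\{0\}$, and that satisfies $\mathrm{Det}(\mathcal I)=1$. For a real tensor $\mathcal T$, a number $\lambda\in\mathbb C$ is an eigenvalue if $(\lambda\mathcal I-\mathcal T)\mathbf x^{k-1}=0$ for some $\mathbf x\in\mathbb C^n\setminus\{0\}$; its algebraic multiplicity is its multiplicity as a root of the characteristic polynomial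 $\chi_{\mathcal T}(\lambda)=\mathrm{Det}(\lambda\mathcal I-\mathcal T)\in\mathbb C[\lambda]$; and the spectrum of $\mathcal T$ is the set of its eigenvalues, with their algebraic multiplicities. Let $G=(V,E)$ be a $k$-uniform hypergraph with $V=[n]$ (so $E$ is a set of $k$-element subsets of $V$). Its adjacency tensor $\mathcal A$ has entry $a_{i_1\ldots i_k}=\frac1{(k-1)!}$ if $\{i_1,\ldots,i_k\}\in E$ and $0$ otherwise, and $\mathcal D$ is the diagonal tensor whose entry $d_{i\ldots i}$ is the degree of $i$, i.e. the number of edges that contain $i$. The Laplacian tensor of $G$ is $\mathcal D-\mathcal A$ and the signless Laplacian tensor of $G$ is $\mathcal D+\mathcal A$. The hypergraph $G$ is called hm-bipartite if either $E=\emptyset$ or $V$ is the disjoint union of two nonempty sets $V_1,V_2$ such that every edge has exactly one vertex in $V_1$ and its other $k-1$ vertices in $V_2$. **Proposition.** If $k$ is even and $G$ is hm-bipartite, then the spectrum of the Laplacian tensor $\mathcal D-\mathcal A$ and the spectrum of the signless Laplacian tensor $\mathcal D+\mathcal A$ are equal: the two tensors have the same eigenvalues, with the same algebraic multiplicities. 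-/

import Mathlib

open MvPolynomial

/-- A tensor (hypermatrix) of order `k` and dimension `n` with entries in `R`, given by its entries
`t_{i₁ i₂ … i_k}`; the multi-index is written as the pair `(i₁, (i₂, …, i_k))`. -/
abbrev HyperTensor (R : Type*) (k n : ℕ) : Type _ := Fin n × (Fin (k - 1) → Fin n) → R

namespace HyperTensor

/-- The vector `T x^{k-1}`, with coordinates `∑_{i₂,…,i_k} t_{i i₂ … i_k} x_{i₂} ⋯ x_{i_k}`. -/
def apply {R : Type*} [CommSemiring R] {k n : ℕ} (T : HyperTensor R k n) (x : Fin n → R)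
    (i : Fin n) : R :=
  ∑ J : Fin (k - 1) → Fin n, T (i, J) * ∏ l, x (J l)

/-- The identity tensor: the entry is `1` if all indices are equal, and `0` otherwise. -/
def identity (R : Type*) [CommSemiring R] (k n : ℕ) : HyperTensor R k n :=
  fun p => if ∀ l, p.2 l = p.1 then 1 else 0

/-- The polynomial system `T x^{k-1} = 0` has a solution `x ≠ 0` in `ℂⁿ`. -/
def IsSingular {k n : ℕ} (T : HyperTensor ℂ k n) : Prop :=
  ∃ x : Fin n → ℂ, x ≠ 0 ∧ T.apply x = 0

/-- `D`, a polynomial in the entries of a tensor of order `k` and dimension `n`, is the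
determinant, i.e. the resultant of the system `T x^{k-1} = 0`: it is irreducible, it vanishes
exactly at those complex tensors for which the system has a nontrivial solution, and its value at
the identity tensor is `1`. That there is exactly one such polynomial (for `k ≥ 2` and `n ≥ 1`)
is shown in `exists_isDeterminant` and `IsDeterminant.unique` below. -/
structure IsDeterminant (k n : ℕ) (D : MvPolynomial (Fin n × (Fin (k - 1) → Fin n)) ℂ) :
    Prop where
  irreducible : Irreducible D
  aeval_eq_zero_iff : ∀ T : HyperTensor ℂ k n, aeval T D = 0 ↔ T.IsSingular
  aeval_identity : aeval (identity ℂ k n) D = 1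

/-! The next declarations prove that the determinant exists and is unique. -/

variable {k n : ℕ}

theorem apply_identity {R : Type*} [CommSemiring R] (x : Fin n → R) (i : Fin n) :
    (identity R k n).apply x i = x i ^ (k - 1) := by
  rw [apply, Finset.sum_eq_single (fun _ => i)]
  · simp [identity]
  · intro J _ hJ
    have : ¬ ∀ l, J l = i := fun h => hJ (funext h)
    simp [identity, this]
  · simp

theorem not_isSingular_identity (hk : 2 ≤ k) : ¬ (identity ℂ k n).IsSingular := by
  rintro ⟨x, hx, h⟩
  apply hx
  funext i
  have := congrFun h i
  rw [apply_identity] at this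
  exact pow_eq_zero_iff (by omega) |>.1 this

/-- The ideal of polynomials in the entries that vanish at all singular tensors. -/
noncomputable def singularIdeal (k n : ℕ) :
    Ideal (MvPolynomial (Fin n × (Fin (k - 1) → Fin n)) ℂ) :=
  vanishingIdeal ℂ {T : HyperTensor ℂ k n | T.IsSingular}

theorem mem_singularIdeal {P : MvPolynomial (Fin n × (Fin (k - 1) → Fin n)) ℂ} :
    P ∈ singularIdeal k n ↔ ∀ T : HyperTensor ℂ k n, T.IsSingular → aeval T P = 0 := by
  simp [singularIdeal, mem_vanishingIdeal_iff]

/-- A polynomial parametrization of the singular tensors. -/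
noncomputable def singularParam (k n : ℕ) (p : Fin n × (Fin (k - 1) → Fin n)) :
    MvPolynomial ((Fin n × (Fin (k - 1) → Fin n)) ⊕ (Fin n ⊕ Fin n)) ℂ :=
  (∑ a, X (.inr (.inl a)) * X (.inr (.inr a))) ^ (k - 1) * X (.inl p) -
    (∑ J : Fin (k - 1) → Fin n, X (.inl (p.1, J)) * ∏ l, X (.inr (.inl (J l)))) *
      ∏ l, X (.inr (.inr (p.2 l)))

theorem prod_sum_pow {R : Type*} [CommSemiring R] (x y : Fin n → R) :
    ∑ J : Fin (k - 1) → Fin n, (∏ l, y (J l)) * ∏ l, x (J l) = (∑ a, x a * y a) ^ (k - 1) := by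
  have := Finset.prod_univ_sum (fun _ : Fin (k - 1) => (Finset.univ : Finset (Fin n)))
    (fun _ a => x a * y a)
  simp only [Finset.prod_const, Finset.card_univ, Fintype.card_fin] at this
  rw [this]
  simp [Finset.prod_mul_distrib, mul_comm]

theorem isSingular_singularParam (hk : 2 ≤ k) (hn : 0 < n)
    (w : (Fin n × (Fin (k - 1) → Fin n)) ⊕ (Fin n ⊕ Fin n) → ℂ) :
    IsSingular (fun p : Fin n × (Fin (k - 1) → Fin n) => aeval w (singularParam k n p)) := by
  by_cases hx : (fun a => w (.inr (.inl a))) = 0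
  · refine ⟨fun _ => 1, fun h => one_ne_zero (congrFun h ⟨0, hn⟩), ?_⟩
    have hx' : ∀ a, w (.inr (.inl a)) = 0 := fun a => congrFun hx a
    funext i
    have hk0 : k - 1 ≠ 0 := by omega
    simp [apply, singularParam, hx', hk0]
  · refine ⟨_, hx, ?_⟩
    funext i
    simp only [apply, singularParam, map_sub, map_mul, map_pow, map_sum, map_prod, aeval_X,
      sub_mul, Finset.sum_sub_distrib, Pi.zero_apply, mul_assoc]
    rw [← Finset.mul_sum, ← Finset.mul_sum,
      prod_sum_pow (fun a => w (.inr (.inl a))) (fun a => w (.inr (.inr a)))]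
    ring

theorem exists_singularParam {T : HyperTensor ℂ k n} (hT : T.IsSingular) :
    ∃ w, (fun p => aeval w (singularParam k n p)) = T := by
  obtain ⟨x, hx, h⟩ := hT
  obtain ⟨j, hj⟩ := Function.ne_iff.1 hx
  refine ⟨Sum.elim T (Sum.elim x (Pi.single j (x j)⁻¹)), ?_⟩
  funext p
  have h1 : ∑ J : Fin (k - 1) → Fin n, T (p.1, J) * ∏ l, x (J l) = 0 := congrFun h p.1
  have h2 : ∑ a, x a * (Pi.single j (x j)⁻¹ : Fin n → ℂ) a = 1 := by
    rw [Finset.sum_eq_single j]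
    · simpa using mul_inv_cancel₀ hj
    · intro b _ hb; simp [hb]
    · simp
  simp [singularParam, h1, h2]

theorem mem_singularIdeal_iff_bind₁ (hk : 2 ≤ k) (hn : 0 < n)
    {P : MvPolynomial (Fin n × (Fin (k - 1) → Fin n)) ℂ} :
    P ∈ singularIdeal k n ↔ bind₁ (singularParam k n) P = 0 := by
  rw [mem_singularIdeal]
  constructor
  · intro h
    apply MvPolynomial.funext
    intro w
    have := h _ (isSingular_singularParam hk hn w)
    rw [← aeval_bind₁] at this
    simpa [aeval_eq_eval] using this
  · intro h T hT
    obtain ⟨w, rfl⟩ := exists_singularParam hT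
    rw [← aeval_bind₁, h, map_zero]

theorem isPrime_singularIdeal (hk : 2 ≤ k) (hn : 0 < n) : (singularIdeal k n).IsPrime := by
  have : singularIdeal k n = RingHom.ker (bind₁ (singularParam k n)) := by
    ext P
    rw [mem_singularIdeal_iff_bind₁ hk hn, RingHom.mem_ker]
  rw [this]
  exact RingHom.ker_isPrime _

theorem homogeneousComponent_mul' {σ : Type*} {d e : ℕ} (h g : MvPolynomial σ ℂ)
    (hg : g.IsHomogeneous d) :
    homogeneousComponent (e + d) (h * g) = homogeneousComponent e h * g := by
  conv_lhs => rw [← sum_homogeneousComponent h, Finset.sum_mul, map_sum]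
  have key : ∀ j, homogeneousComponent (e + d) (homogeneousComponent j h * g) =
      if j = e then homogeneousComponent e h * g else 0 := by
    intro j
    have hj : (homogeneousComponent j h * g).IsHomogeneous (j + d) :=
      (homogeneousComponent_isHomogeneous j h).mul hg
    rw [homogeneousComponent_of_mem hj]
    by_cases hje : j = e
    · subst hje; simp
    · simp [hje, Ne.symm hje]
  simp only [key, Finset.sum_ite_eq', Finset.mem_range]
  split_ifs with hlt
  · rfl
  · rw [homogeneousComponent_eq_zero _ _ (by omega), zero_mul]

/-- The forms `(T x^{k-1})_i` as polynomials in `x`. -/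
noncomputable def form (T : HyperTensor ℂ k n) (i : Fin n) : MvPolynomial (Fin n) ℂ :=
  ∑ J : Fin (k - 1) → Fin n, C (T (i, J)) * ∏ l, X (J l)

theorem aeval_form (T : HyperTensor ℂ k n) (i : Fin n) (x : Fin n → ℂ) :
    aeval x (T.form i) = T.apply x i := by
  simp [form, apply, aeval_eq_eval]

theorem isHomogeneous_prod_X (J : Fin (k - 1) → Fin n) :
    (∏ l, X (J l) : MvPolynomial (Fin n) ℂ).IsHomogeneous (k - 1) := by
  have := IsHomogeneous.prod Finset.univ (fun l => (X (J l) : MvPolynomial (Fin n) ℂ))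
    (fun _ => 1) (fun l _ => isHomogeneous_X _ _)
  simpa using this

theorem isHomogeneous_form (T : HyperTensor ℂ k n) (i : Fin n) :
    (T.form i).IsHomogeneous (k - 1) := by
  apply IsHomogeneous.sum
  intro J _
  simpa using (isHomogeneous_C (Fin n) (T (i, J))).mul (isHomogeneous_prod_X J)

theorem sum_coeff_mul_aeval {N : ℕ} (g : MvPolynomial (Fin n) ℂ) (hg : g.IsHomogeneous N)
    (x : Fin n → ℂ) :
    ∑ b : (Finset.univ : Finset (Fin n)).finsuppAntidiag N,
      coeff b.1 g * aeval x (monomial b.1 (1 : ℂ)) = aeval x g := by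
  rw [Finset.sum_coe_sort ((Finset.univ : Finset (Fin n)).finsuppAntidiag N)
    (fun b => coeff b g * aeval x (monomial b (1 : ℂ)))]
  conv_rhs => rw [g.as_sum, map_sum]
  symm
  have : ∀ b, aeval x (monomial b (coeff b g)) =
      coeff b g * aeval x (monomial b (1 : ℂ)) := by
    intro b; simp [aeval_monomial]
  simp only [this]
  apply Finset.sum_subset
  · intro b hb
    rw [Finset.mem_finsuppAntidiag]
    refine ⟨?_, by simp⟩
    have := hg (mem_support_iff.1 hb)
    rw [← this, Finsupp.weight_apply, Finsupp.sum_fintype _ _ (by simp)]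
    simp
  · intro b _ hb
    rw [notMem_support_iff.1 hb, zero_mul]

theorem exists_pow_mem {T : HyperTensor ℂ k n} (hT : ¬ T.IsSingular) :
    ∃ N, ∀ j : Fin n, (X j : MvPolynomial (Fin n) ℂ) ^ N ∈ Ideal.span (Set.range T.form) := by
  have h1 : ∀ j : Fin n, ∃ N, (X j : MvPolynomial (Fin n) ℂ) ^ N ∈
      Ideal.span (Set.range T.form) := by
    intro j
    have : (X j : MvPolynomial (Fin n) ℂ) ∈ (Ideal.span (Set.range T.form)).radical := by
      rw [← vanishingIdeal_zeroLocus_eq_radical (K := ℂ), mem_vanishingIdeal_iff]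
      intro x hx
      rw [zeroLocus_span] at hx
      have hx0 : x = 0 := by
        by_contra hne
        refine hT ⟨x, hne, ?_⟩
        funext i
        rw [← aeval_form]
        exact hx _ ⟨i, rfl⟩
      simp [hx0]
    exact this
  choose N hN using h1
  refine ⟨∑ j, N j, fun j => ?_⟩
  exact Ideal.pow_mem_of_pow_mem _ (hN j) (Finset.single_le_sum (fun _ _ => Nat.zero_le _)
    (Finset.mem_univ j))

theorem exists_mem_singularIdeal {T : HyperTensor ℂ k n} (hT : ¬ T.IsSingular) :
    ∃ Q ∈ singularIdeal k n, aeval T Q ≠ 0 := by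
  obtain ⟨N, hN⟩ := exists_pow_mem hT
  set e := n * N + 1 with he
  set S := (Finset.univ : Finset (Fin n)).finsuppAntidiag (e + (k - 1)) with hS
  have hsum : ∀ b ∈ S, ∑ j, b j = e + (k - 1) := fun b hb =>
    (Finset.mem_finsuppAntidiag.1 hb).1
  have hhom : ∀ b ∈ S, (monomial b (1 : ℂ)).IsHomogeneous (e + (k - 1)) := by
    intro b hb
    apply isHomogeneous_monomial
    rw [← hsum b hb, Finsupp.degree_eq_sum]
  have hmem : ∀ b ∈ S, monomial b (1 : ℂ) ∈ Ideal.span (Set.range T.form) := by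
    intro b hb
    have : ∃ j, N ≤ b j := by
      by_contra! hlt
      have : ∑ j, b j ≤ ∑ _j : Fin n, N := Finset.sum_le_sum fun j _ => (hlt j).le
      rw [hsum b hb] at this
      simp at this
      omega
    obtain ⟨j, hj⟩ := this
    have hdvd : (X j : MvPolynomial (Fin n) ℂ) ^ N ∣ monomial b 1 := by
      rw [X_pow_eq_monomial]
      refine ⟨monomial (b - Finsupp.single j N) 1, ?_⟩
      rw [monomial_mul, one_mul, add_tsub_cancel_of_le]
      simpa using hj
    exact Ideal.mem_of_dvd _ hdvd (hN j)
  have hex : ∀ b : S, ∃ h : Fin n → MvPolynomial (Fin n) ℂ,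
      ∑ i, h i * T.form i = monomial b.1 1 := fun b =>
    Ideal.mem_span_range_iff_exists_fun.1 (hmem b.1 b.2)
  choose h hh using hex
  -- the homogeneous coefficients
  let g : S → Fin n → MvPolynomial (Fin n) ℂ := fun b i => homogeneousComponent e (h b i)
  have hg : ∀ b : S, ∑ i, g b i * T.form i = monomial b.1 1 := by
    intro b
    have := congrArg (homogeneousComponent (e + (k - 1))) (hh b)
    rw [map_sum, homogeneousComponent_of_mem (hhom b.1 b.2), if_pos rfl] at this
    rw [← this]
    exact Finset.sum_congr rfl fun i _ =>
      (homogeneousComponent_mul' _ _ (isHomogeneous_form T i)).symm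
  let M : Matrix S S (MvPolynomial (Fin n × (Fin (k - 1) → Fin n)) ℂ) := fun a b =>
    ∑ i, ∑ J : Fin (k - 1) → Fin n, X (i, J) * C (coeff b.1 (g a i * ∏ l, X (J l)))
  have hM : ∀ (T' : HyperTensor ℂ k n) (a b : S),
      aeval T' (M a b) = coeff b.1 (∑ i, g a i * T'.form i) := by
    intro T' a b
    simp only [M, map_sum, map_mul, aeval_X, form, coeff_sum, Finset.mul_sum]
    refine Finset.sum_congr rfl fun i _ => Finset.sum_congr rfl fun J _ => ?_
    rw [mul_left_comm, coeff_C_mul]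
    simp
  have hdet : ∀ T' : HyperTensor ℂ k n,
      aeval T' M.det = (Matrix.of fun a b : S => coeff b.1 (∑ i, g a i * T'.form i)).det := by
    intro T'
    rw [AlgHom.map_det]
    congr 1
    ext a b
    exact hM T' a b
  refine ⟨M.det, mem_singularIdeal.2 ?_, ?_⟩
  · rintro T' ⟨x, hx, hT'⟩
    rw [hdet, ← Matrix.exists_mulVec_eq_zero_iff]
    obtain ⟨j, hj⟩ := Function.ne_iff.1 hx
    refine ⟨fun b => aeval x (monomial b.1 (1 : ℂ)), ?_, ?_⟩
    · have hjS : Finsupp.single j (e + (k - 1)) ∈ S := by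
        rw [hS, Finset.mem_finsuppAntidiag]
        refine ⟨?_, Finset.subset_univ _⟩
        rw [Finset.sum_eq_single j]
        · exact Finsupp.single_eq_same
        · intro b _ hb
          exact Finsupp.single_eq_of_ne hb
        · exact fun h => absurd (Finset.mem_univ j) h
      have hval : aeval x (monomial (Finsupp.single j (e + (k - 1))) (1 : ℂ)) =
          x j ^ (e + (k - 1)) := by
        rw [aeval_monomial, map_one, one_mul]
        exact Finsupp.prod_single_index (pow_zero _)
      intro h0
      have := congrFun h0 ⟨_, hjS⟩
      exact pow_ne_zero _ hj (hval.symm.trans this)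
    · funext a
      simp only [Matrix.mulVec, dotProduct, Matrix.of_apply, Pi.zero_apply]
      rw [sum_coeff_mul_aeval, map_sum]
      · apply Finset.sum_eq_zero
        intro i _
        rw [map_mul, aeval_form, hT']
        simp
      · apply IsHomogeneous.sum
        intro i _
        exact (homogeneousComponent_isHomogeneous _ _).mul (isHomogeneous_form T' i)
  · rw [hdet]
    have : (Matrix.of fun a b : S => coeff b.1 (∑ i, g a i * T.form i)) = 1 := by
      ext a b
      rw [Matrix.of_apply, hg, coeff_monomial, Matrix.one_apply]
      exact if_congr Subtype.ext_iff.symm rfl rfl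
    rw [this, Matrix.det_one]
    exact one_ne_zero

/-- The height of the irrelevant ideal is at least the number of variables. -/
theorem natCast_le_height_ker (n : ℕ) : (n : ℕ∞) ≤
    (RingHom.ker (aeval (fun _ : Fin n => (0 : ℂ)) : MvPolynomial (Fin n) ℂ →ₐ[ℂ] ℂ)).height := by
  let φ : ℕ → MvPolynomial (Fin n) ℂ →ₐ[ℂ] MvPolynomial (Fin n) ℂ := fun j =>
    aeval fun i => if (i : ℕ) < j then 0 else X i
  have hprime : ∀ j, (RingHom.ker (φ j)).IsPrime := fun j => RingHom.ker_isPrime _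
  have hcomp : ∀ j, (φ (j + 1)).comp (φ j) = φ (j + 1) := by
    intro j
    apply algHom_ext
    intro i
    by_cases h : (i : ℕ) < j
    · have h' : (i : ℕ) < j + 1 := by omega
      simp only [φ, AlgHom.comp_apply, aeval_X, h, h', if_true, map_zero]
    · simp only [φ, AlgHom.comp_apply, aeval_X, h, if_false]
  have hlt : ∀ j < n, RingHom.ker (φ j) < RingHom.ker (φ (j + 1)) := by
    intro j hj
    refine lt_of_le_of_ne ?_ ?_
    · intro P hP
      rw [RingHom.mem_ker] at hP ⊢
      rw [← hcomp j, AlgHom.comp_apply, hP, map_zero]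
    · intro heq
      have h1 : (X ⟨j, hj⟩ : MvPolynomial (Fin n) ℂ) ∈ RingHom.ker (φ (j + 1)) := by
        simp [RingHom.mem_ker, φ]
      rw [← heq, RingHom.mem_ker] at h1
      simp [φ] at h1
  have hheight : ∀ j ≤ n, (j : ℕ∞) ≤ (RingHom.ker (φ j)).height := by
    intro j
    induction j with
    | zero => simp
    | succ j ih =>
      intro hj
      by_contra! hcon
      have h2 : (RingHom.ker (φ (j + 1))).height ≤ (j : ℕ) := by
        have : ((j + 1 : ℕ) : ℕ∞) = (j : ℕ∞) + 1 := by push_cast; rfl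
        rw [this] at hcon
        exact Order.le_of_lt_add_one hcon
      rw [Ideal.height_le_iff] at h2
      exact absurd (ih (by omega)) (not_le.2 (h2 _ (hprime j) (hlt j (by omega))))
  refine (hheight n le_rfl).trans (Ideal.height_mono ?_)
  intro P hP
  rw [RingHom.mem_ker] at hP ⊢
  have : ((aeval (fun _ : Fin n => (0 : ℂ))).comp (φ n)) = aeval (fun _ : Fin n => (0 : ℂ)) := by
    apply algHom_ext
    intro i
    simp [φ]
  rw [← this, AlgHom.comp_apply, hP, map_zero]

/-- One form less than variables: there is a common nontrivial zero. -/
theorem exists_common_zero (i₀ : Fin n) (f : Fin n → MvPolynomial (Fin n) ℂ)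
    (hf : ∀ i, aeval (fun _ => (0 : ℂ)) (f i) = 0) :
    ∃ x : Fin n → ℂ, x ≠ 0 ∧ ∀ i, i ≠ i₀ → aeval x (f i) = 0 := by
  by_contra! hcon
  set s : Set (MvPolynomial (Fin n) ℂ) := f '' {i₀}ᶜ with hs
  set m := RingHom.ker (aeval (fun _ : Fin n => (0 : ℂ)) : MvPolynomial (Fin n) ℂ →ₐ[ℂ] ℂ)
    with hm
  have hle : Ideal.span s ≤ m := by
    rw [Ideal.span_le]
    rintro _ ⟨i, _, rfl⟩
    exact hf i
  have hmp : m.IsPrime := RingHom.ker_isPrime _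
  have hml : m ≤ (Ideal.span s).radical := by
    intro P hP
    rw [← vanishingIdeal_zeroLocus_eq_radical (K := ℂ), mem_vanishingIdeal_iff]
    intro x hx
    rw [zeroLocus_span] at hx
    have hx0 : x = 0 := by
      by_contra hne
      obtain ⟨i, hi, h⟩ := hcon x hne
      exact h (hx _ ⟨i, hi, rfl⟩)
    rw [hx0]
    exact hP
  have hmin : m ∈ (Ideal.span s).minimalPrimes := by
    refine ⟨⟨hmp, hle⟩, ?_⟩
    rintro q ⟨hq, hsq⟩ _
    exact hml.trans (hq.radical_le_iff.2 hsq)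
  have h1 := Ideal.height_le_spanRank_toENat_of_mem_minimalPrimes _ _ hmin
  have hfin : s.Finite := Set.toFinite _
  have h2 : Cardinal.toENat (Submodule.spanRank (Ideal.span s)) ≤ (s.ncard : ℕ∞) := by
    have : Submodule.spanRank (Ideal.span s) ≤ Cardinal.mk s := Submodule.spanRank_span_le_card s
    refine (OrderHomClass.mono Cardinal.toENat this).trans ?_
    rw [hfin.cast_ncard_eq]
    exact le_rfl
  have h3 : s.ncard ≤ n - 1 := by
    refine (Set.ncard_image_le (Set.toFinite _)).trans ?_
    rw [Set.ncard_compl]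
    simp
  have h4 := (natCast_le_height_ker n).trans (h1.trans h2)
  have h5 : n ≤ s.ncard := by exact_mod_cast h4
  have := i₀.pos
  omega

/-- No nonzero element of the ideal is independent of the entry `(i₀, i₀, …, i₀)`. -/
theorem eq_zero_of_mem_singularIdeal (hk : 2 ≤ k) (i₀ : Fin n)
    {P : MvPolynomial (Fin n × (Fin (k - 1) → Fin n)) ℂ} (hP : P ∈ singularIdeal k n)
    (hind : ∀ (T : HyperTensor ℂ k n) (v : ℂ),
      aeval (Function.update T (i₀, fun _ => i₀) v) P = aeval T P) : P = 0 := by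
  by_contra hne
  have hk0 : k - 1 ≠ 0 := by omega
  obtain ⟨Q, hQ, hQid⟩ := exists_mem_singularIdeal (not_isSingular_identity (n := n) hk)
  let repl : HyperTensor ℂ k n → HyperTensor ℂ k n := fun T p =>
    if p.1 = i₀ then identity ℂ k n p else T p
  let Q' : MvPolynomial (Fin n × (Fin (k - 1) → Fin n)) ℂ :=
    bind₁ (fun p => if p.1 = i₀ then C (identity ℂ k n p) else X p) Q
  have hQ' : ∀ T : HyperTensor ℂ k n, aeval T Q' = aeval (repl T) Q := by
    intro T
    rw [aeval_bind₁]
    congr 2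
    funext p
    by_cases hp : p.1 = i₀ <;> simp [repl, hp]
  have hQ'0 : Q' ≠ 0 := by
    intro h0
    have := hQ' (identity ℂ k n)
    have hr : repl (identity ℂ k n) = identity ℂ k n := by
      funext p
      simp [repl]
    rw [h0, map_zero, hr] at this
    exact hQid this.symm
  have : ∃ T : HyperTensor ℂ k n, aeval T (P * Q') ≠ 0 := by
    by_contra! h
    apply mul_ne_zero hne hQ'0
    apply MvPolynomial.funext
    intro T
    simpa [aeval_eq_eval] using h T
  obtain ⟨T, hT⟩ := this
  rw [map_mul] at hT
  have hTP := left_ne_zero_of_mul hT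
  have hTQ := right_ne_zero_of_mul hT
  rw [hQ'] at hTQ
  have hz : ∀ i, aeval (fun _ => (0 : ℂ)) (T.form i) = 0 := by
    intro i
    rw [aeval_form]
    simp [apply, hk0]
  obtain ⟨x, hx, hxi⟩ := exists_common_zero i₀ T.form hz
  by_cases hx0 : x i₀ = 0
  · apply hTQ
    refine mem_singularIdeal.1 hQ _ ⟨x, hx, ?_⟩
    funext i
    by_cases hi : i = i₀
    · subst hi
      have : (repl T).apply x i = (identity ℂ k n).apply x i := by
        simp [apply, repl]
      rw [this, apply_identity, hx0, zero_pow hk0]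
      rfl
    · have : (repl T).apply x i = T.apply x i := by
        simp [apply, repl, hi]
      rw [this, ← aeval_form, hxi i hi]
      rfl
  · apply hTP
    have hpow : x i₀ ^ (k - 1) ≠ 0 := pow_ne_zero _ hx0
    rw [← hind T (T (i₀, fun _ => i₀) - T.apply x i₀ / x i₀ ^ (k - 1))]
    refine mem_singularIdeal.1 hP _ ⟨x, hx, ?_⟩
    have hupd : ∀ v, Function.update T (i₀, fun _ => i₀) (T (i₀, fun _ => i₀) + v) =
        fun p => T p + (if p = (i₀, fun _ => i₀) then v else 0) := by
      intro v
      funext p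
      by_cases hp : p = (i₀, fun _ => i₀)
      · subst hp; simp
      · simp [hp]
    rw [sub_eq_add_neg, hupd]
    funext i
    simp only [apply, add_mul, Finset.sum_add_distrib, Pi.zero_apply, Prod.mk.injEq]
    by_cases hi : i = i₀
    · subst hi
      simp only [true_and, ite_mul, zero_mul, Finset.sum_ite_eq', Finset.mem_univ, if_true,
        Finset.prod_const, Finset.card_univ, Fintype.card_fin]
      rw [neg_mul, div_mul_cancel₀ _ hpow]
      exact add_neg_cancel _
    · simp only [hi, false_and, if_false, zero_mul, Finset.sum_const_zero, add_zero]
      have := hxi i hi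
      rwa [aeval_form] at this

/-- Elimination: an irreducible polynomial not dividing another one. -/
theorem exists_C_mem_span {B : Type*} [CommRing B] [IsDomain B] [UniqueFactorizationMonoid B]
    (R Q : Polynomial B) (hR : Irreducible R) (hQ : ¬ R ∣ Q) :
    ∃ b : B, b ≠ 0 ∧ Polynomial.C b ∈ Ideal.span {R, Q} := by
  by_cases hdeg : R.natDegree = 0
  · refine ⟨R.coeff 0, ?_, ?_⟩
    · intro h
      rw [Polynomial.eq_C_of_natDegree_eq_zero hdeg, h] at hR
      simp at hR
    · rw [← Polynomial.eq_C_of_natDegree_eq_zero hdeg]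
      exact Ideal.subset_span (by simp)
  · have hprim := hR.isPrimitive hdeg
    have hirr := (hprim.irreducible_iff_irreducible_map_fraction_map (K := FractionRing B)).1 hR
    have hnd : ¬ R.map (algebraMap B (FractionRing B)) ∣ Q.map (algebraMap B (FractionRing B)) :=
      fun h => hQ (hprim.dvd_of_fraction_map_dvd_fraction_map h)
    have hcop := (hirr.coprime_iff_not_dvd).2 hnd
    have hres := Polynomial.resultant_ne_zero _ _ hcop
    have hinj := IsFractionRing.injective B (FractionRing B)
    rw [Polynomial.resultant_map_map, Polynomial.natDegree_map_eq_of_injective hinj,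
      Polynomial.natDegree_map_eq_of_injective hinj] at hres
    obtain ⟨p, q, -, -, hpq⟩ := Polynomial.exists_mul_add_mul_eq_C_resultant R Q le_rfl le_rfl
      (Or.inl hdeg)
    refine ⟨R.resultant Q, fun h => hres (by rw [h, map_zero]), ?_⟩
    rw [← hpq, Ideal.mem_span_pair]
    exact ⟨p, q, by ring⟩

theorem dvd_of_mem_singularIdeal (hk : 2 ≤ k) (hn : 0 < n)
    {R Q : MvPolynomial (Fin n × (Fin (k - 1) → Fin n)) ℂ} (hR : Irreducible R)
    (hRI : R ∈ singularIdeal k n) (hQI : Q ∈ singularIdeal k n) : R ∣ Q := by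
  by_contra hndvd
  let i₀ : Fin n := ⟨0, hn⟩
  let v₀ : Fin n × (Fin (k - 1) → Fin n) := (i₀, fun _ => i₀)
  let φ : MvPolynomial (Fin n × (Fin (k - 1) → Fin n)) ℂ ≃ₐ[ℂ]
      Polynomial (MvPolynomial {p // p ≠ v₀} ℂ) :=
    (renameEquiv ℂ (Equiv.optionSubtypeNe v₀).symm).trans (optionEquivLeft ℂ {p // p ≠ v₀})
  obtain ⟨b, hb, hmem⟩ := exists_C_mem_span (φ R) (φ Q)
    ((MulEquiv.irreducible_iff φ.toMulEquiv).2 hR) (fun h => hndvd ((map_dvd_iff φ).1 h))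
  have hsymm : φ.symm (Polynomial.C b) = rename Subtype.val b := by
    rw [AlgEquiv.symm_apply_eq]
    simp only [φ, AlgEquiv.trans_apply, renameEquiv_apply, rename_rename]
    have : (⇑(Equiv.optionSubtypeNe v₀).symm ∘ Subtype.val : {p // p ≠ v₀} → _) = some := by
      funext p
      rw [Function.comp_apply, Equiv.symm_apply_eq]
      rfl
    rw [this, optionEquivLeft_apply, aeval_rename]
    clear hb hmem this
    induction b using MvPolynomial.induction_on with
    | C a => simp
    | add p q hp hq => rw [map_add, map_add, hp, hq]
    | mul_X p i hp => rw [map_mul, map_mul, hp]; simp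
  rw [Ideal.mem_span_pair] at hmem
  obtain ⟨p, q, hpq⟩ := hmem
  have hI : rename Subtype.val b ∈ singularIdeal k n := by
    rw [← hsymm, ← hpq, map_add, map_mul, map_mul, AlgEquiv.symm_apply_apply,
      AlgEquiv.symm_apply_apply]
    exact Ideal.add_mem _ (Ideal.mul_mem_left _ _ hRI) (Ideal.mul_mem_left _ _ hQI)
  have h0 := eq_zero_of_mem_singularIdeal hk i₀ hI (by
    intro T v
    rw [aeval_rename, aeval_rename]
    congr 2
    funext p
    exact Function.update_of_ne p.2 _ _)
  exact hb (rename_injective _ Subtype.val_injective (by rw [h0, map_zero]))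

/-- The determinant exists. -/
theorem exists_isDeterminant (hk : 2 ≤ k) (hn : 0 < n) : ∃ D, IsDeterminant k n D := by
  have hid := not_isSingular_identity (n := n) hk
  obtain ⟨Q, hQ, hQid⟩ := exists_mem_singularIdeal hid
  have hbot : singularIdeal k n ≠ ⊥ := by
    intro h
    rw [h, Ideal.mem_bot] at hQ
    rw [hQ, map_zero] at hQid
    exact hQid rfl
  obtain ⟨R, hRI, hR⟩ := (isPrime_singularIdeal hk hn).exists_mem_prime_of_ne_bot hbot
  have hzero : ∀ T : HyperTensor ℂ k n, aeval T R = 0 ↔ T.IsSingular := by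
    intro T
    refine ⟨fun h => ?_, fun h => mem_singularIdeal.1 hRI T h⟩
    by_contra hT
    obtain ⟨P, hP, hPT⟩ := exists_mem_singularIdeal hT
    obtain ⟨S, rfl⟩ := dvd_of_mem_singularIdeal hk hn hR.irreducible hRI hP
    rw [map_mul, h, zero_mul] at hPT
    exact hPT rfl
  have hRid : aeval (identity ℂ k n) R ≠ 0 := fun h => hid ((hzero _).1 h)
  have hu : IsUnit (C (aeval (identity ℂ k n) R)⁻¹ :
      MvPolynomial (Fin n × (Fin (k - 1) → Fin n)) ℂ) :=
    (isUnit_iff_ne_zero.2 (inv_ne_zero hRid)).map C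
  refine ⟨C (aeval (identity ℂ k n) R)⁻¹ * R, ?_, ?_, ?_⟩
  · exact (irreducible_isUnit_mul hu).2 hR.irreducible
  · intro T
    rw [← hzero, map_mul, mul_eq_zero, aeval_C]
    exact or_iff_right (inv_ne_zero hRid)
  · rw [map_mul, aeval_C]
    exact inv_mul_cancel₀ hRid

/-- The determinant is unique. -/
theorem IsDeterminant.unique {D D' : MvPolynomial (Fin n × (Fin (k - 1) → Fin n)) ℂ}
    (hD : IsDeterminant k n D) (hD' : IsDeterminant k n D') : D = D' := by
  have key : ∀ {D D' : MvPolynomial (Fin n × (Fin (k - 1) → Fin n)) ℂ},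
      IsDeterminant k n D → IsDeterminant k n D' → D ∣ D' := by
    intro D D' hD hD'
    have hrad : D' ∈ (Ideal.span {D}).radical := by
      rw [← vanishingIdeal_zeroLocus_eq_radical (K := ℂ), mem_vanishingIdeal_iff]
      intro T hT
      rw [zeroLocus_span] at hT
      exact (hD'.aeval_eq_zero_iff T).2 ((hD.aeval_eq_zero_iff T).1 (hT _ rfl))
    obtain ⟨N, hN⟩ := hrad
    exact hD.irreducible.prime.dvd_of_dvd_pow (Ideal.mem_span_singleton.1 hN)
  obtain ⟨u, hu⟩ := associated_of_dvd_dvd (key hD hD') (key hD' hD)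
  obtain ⟨c, -, hc⟩ := (MvPolynomial.isUnit_iff_eq_C_of_isReduced).1 u.isUnit
  have h1 := hD'.aeval_identity
  rw [← hu, hc, map_mul, hD.aeval_identity, one_mul] at h1
  have hc1 : c = 1 := by simpa using h1
  rw [← hu, hc, hc1, map_one, mul_one]

/-- The determinant of tensors of order `k` and dimension `n`, as a polynomial in the entries. -/
noncomputable def determinant (k n : ℕ) : MvPolynomial (Fin n × (Fin (k - 1) → Fin n)) ℂ :=
  Classical.epsilon (IsDeterminant k n)

theorem isDeterminant_determinant (hk : 2 ≤ k) (hn : 0 < n) :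
    IsDeterminant k n (determinant k n) :=
  Classical.epsilon_spec (exists_isDeterminant hk hn)

/-- The tensor `lam I - T`, for a real tensor `T` and an element `lam` of a complex algebra. -/
noncomputable def shift {S : Type*} [CommRing S] [Algebra ℂ S] (lam : S)
    (T : HyperTensor ℝ k n) : HyperTensor S k n :=
  fun p => lam * identity S k n p - algebraMap ℂ S (T p : ℂ)

/-- `lam` is an eigenvalue of the real tensor `T`: the system `(lam I - T) x^{k-1} = 0` has a
solution `x ≠ 0` in `ℂⁿ`. -/
def IsEigenvalue (T : HyperTensor ℝ k n) (lam : ℂ) : Prop :=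
  ∃ x : Fin n → ℂ, x ≠ 0 ∧ (shift lam T).apply x = 0

/-- The characteristic polynomial `Det(λ I - T) ∈ ℂ[λ]`. -/
noncomputable def charpoly (T : HyperTensor ℝ k n) : Polynomial ℂ :=
  aeval (shift (Polynomial.X : Polynomial ℂ) T) (determinant k n)

/-- The spectrum of a real tensor: the set of its eigenvalues, each one together with its algebraic
multiplicity, which is its multiplicity as a root of the characteristic polynomial. -/
noncomputable def spectrum (T : HyperTensor ℝ k n) : Set (ℂ × ℕ) :=
  {q | T.IsEigenvalue q.1 ∧ q.2 = T.charpoly.rootMultiplicity q.1}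

end HyperTensor

namespace Hypergraph

/-- A `k`-uniform hypergraph with vertex set `{1, …, n}` (here all of `Fin n`): every edge has
exactly `k` elements. -/
structure IsUniformOn {n : ℕ} (G : Hypergraph (Fin n)) (k : ℕ) : Prop where
  vertexSet_eq : G.vertexSet = Set.univ
  ncard_edge : ∀ e ∈ G.edgeSet, e.ncard = k

/-- A `k`-uniform hypergraph is hm-bipartite if it has no edge, or if its vertex set is the
disjoint union of two nonempty sets `V₁`, `V₂` such that every edge has exactly one vertex in `V₁`
and the other `k - 1` vertices in `V₂`. -/
def IsHmBipartite {n : ℕ} (G : Hypergraph (Fin n)) (k : ℕ) : Prop :=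
  G.edgeSet = ∅ ∨ ∃ V₁ V₂ : Set (Fin n), V₁ ∪ V₂ = G.vertexSet ∧ Disjoint V₁ V₂ ∧
    V₁.Nonempty ∧ V₂.Nonempty ∧
    ∀ e ∈ G.edgeSet, (e ∩ V₁).ncard = 1 ∧ (e ∩ V₂).ncard = k - 1

/-- The degree of a vertex: the number of edges that contain it. -/
noncomputable def degree {n : ℕ} (G : Hypergraph (Fin n)) (i : Fin n) : ℕ :=
  {e | e ∈ G.edgeSet ∧ i ∈ e}.ncard

open Classical in
/-- The adjacency tensor: `a_{i₁ … i_k} = 1 / (k-1)!` if `{i₁, …, i_k}` is an edge, else `0`. -/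
noncomputable def adjacencyTensor {n : ℕ} (G : Hypergraph (Fin n)) (k : ℕ) : HyperTensor ℝ k n :=
  fun p => if insert p.1 (Set.range p.2) ∈ G.edgeSet then 1 / ((k - 1).factorial : ℝ) else 0

/-- The diagonal tensor of the degrees. -/
noncomputable def degreeTensor {n : ℕ} (G : Hypergraph (Fin n)) (k : ℕ) : HyperTensor ℝ k n :=
  fun p => if ∀ l, p.2 l = p.1 then (G.degree p.1 : ℝ) else 0

/-- The Laplacian tensor `D - A`. -/
noncomputable def laplacianTensor {n : ℕ} (G : Hypergraph (Fin n)) (k : ℕ) : HyperTensor ℝ k n :=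
  G.degreeTensor k - G.adjacencyTensor k

/-- The signless Laplacian tensor `D + A`. -/
noncomputable def signlessLaplacianTensor {n : ℕ} (G : Hypergraph (Fin n)) (k : ℕ) :
    HyperTensor ℝ k n :=
  G.degreeTensor k + G.adjacencyTensor k

end Hypergraph

/-! Multiply each entry `t_{i₁…i_k}` by `ε_{i₁}⋯ε_{i_k}`, where `ε` is a vector of signs. In the
system `T x^{k-1} = 0` this amounts to replacing `x` by `εx` and multiplying the `i`-th equation by
`ε_i`, so singularity is preserved (`isSingular_signTwist_iff`). For even `k` the identity tensor is
fixed, because `ε_i^k = 1`. Hence `Det` composed with the twist again has the three defining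
properties of the determinant, and by uniqueness it is `Det` itself, as a polynomial
(`aeval_signTwist_determinant`). The twist also commutes with `T ↦ λI - T`, so eigenvalues and
characteristic polynomial are unchanged (`spectrum_signTwist`).

Now let `ε` be `-1` exactly on `V₁`. An edge meets `V₁` in one vertex, so its entries in `A` change
sign, while the diagonal tensor `D` is fixed: the twist of `D - A` is `D + A`
(`signTwist_laplacianTensor`). -/

namespace HyperTensor

/-! ### Sign twists of tensors and of their zeros -/

/-- The sign `ε_{i₁} ε_{i₂} ⋯ ε_{i_k}` attached to a multi-index by a sign vector `ε`. -/
def indexSign {k n : ℕ} (ε : Fin n → ℤˣ) (p : Fin n × (Fin (k - 1) → Fin n)) : ℤˣ :=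
  ε p.1 * ∏ l, ε (p.2 l)

/-- The tensor with entries `ε_{i₁} ⋯ ε_{i_k} t_{i₁ … i_k}`. -/
def signTwist {R : Type*} [CommRing R] {k n : ℕ} (ε : Fin n → ℤˣ) (T : HyperTensor R k n) :
    HyperTensor R k n :=
  fun p => ((indexSign ε p : ℤ) : R) * T p

variable {R : Type*} [CommRing R] {k n : ℕ} (ε : Fin n → ℤˣ)

theorem units_cast_mul_self (u : ℤˣ) : ((u : ℤ) : R) * ((u : ℤ) : R) = 1 := by
  rw [← Int.cast_mul, ← Units.val_mul, Int.units_mul_self]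
  simp

theorem signTwist_signTwist (T : HyperTensor R k n) : signTwist ε (signTwist ε T) = T := by
  funext p
  simp only [signTwist]
  rw [← mul_assoc, units_cast_mul_self, one_mul]

theorem indexSign_of_forall_eq (hk : Even k) (hk0 : k ≠ 0)
    {p : Fin n × (Fin (k - 1) → Fin n)} (hp : ∀ l, p.2 l = p.1) : indexSign ε p = 1 := by
  -- The sign is `ε^(k-1+1)`. Subtraction is truncated, so at `k = 0` this would be `ε`, not `ε^0`;
  -- `hk0` rules this out.
  have h : k - 1 + 1 = k := by omega
  simp only [indexSign, hp, Finset.prod_const, Finset.card_univ, Fintype.card_fin]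
  rw [← pow_succ', h]
  obtain ⟨m, rfl⟩ := hk
  rw [pow_add, Int.units_mul_self]

theorem signTwist_identity (hk : Even k) (hk0 : k ≠ 0) :
    signTwist ε (identity R k n) = identity R k n := by
  funext p
  simp only [signTwist, identity]
  split_ifs with h
  · simp [indexSign_of_forall_eq ε hk hk0 h]
  · simp

/-- The factors at `i₂, …, i_k` are absorbed by the variables, and the factor at the first index
comes out of the sum. -/
theorem apply_signTwist (T : HyperTensor R k n) (x : Fin n → R) (i : Fin n) :
    (signTwist ε T).apply x i =
      ((ε i : ℤ) : R) * T.apply (fun j => ((ε j : ℤ) : R) * x j) i := by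
  simp only [apply, signTwist, indexSign, Finset.mul_sum, Finset.prod_mul_distrib]
  refine Finset.sum_congr rfl fun J _ => ?_
  push_cast
  ring

theorem IsSingular.signTwist {T : HyperTensor ℂ k n} (hT : T.IsSingular) :
    (signTwist ε T).IsSingular := by
  obtain ⟨x, hx, h⟩ := hT
  -- The zero of the twisted tensor is `εx`; since `ε² = 1`, the twist turns it back into `x`.
  have hinv : ∀ j, ((ε j : ℤ) : ℂ) * (((ε j : ℤ) : ℂ) * x j) = x j := fun j => by
    rw [← mul_assoc, units_cast_mul_self, one_mul]
  refine ⟨fun j => ((ε j : ℤ) : ℂ) * x j, fun h0 => hx ?_, ?_⟩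
  · funext j
    rw [← hinv j, show ((ε j : ℤ) : ℂ) * x j = 0 from congrFun h0 j, mul_zero, Pi.zero_apply]
  · funext i
    rw [apply_signTwist, funext hinv, h, Pi.zero_apply, mul_zero]

theorem isSingular_signTwist_iff {T : HyperTensor ℂ k n} :
    (signTwist ε T).IsSingular ↔ T.IsSingular :=
  ⟨fun h => signTwist_signTwist ε T ▸ h.signTwist ε, fun h => h.signTwist ε⟩

/-! ### Invariance of the determinant -/

/-- The substitution `t_p ↦ ε_p t_p` in the polynomials in the entries of a tensor. -/
noncomputable def signTwistHom (k : ℕ) {n : ℕ} (ε : Fin n → ℤˣ) :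
    MvPolynomial (Fin n × (Fin (k - 1) → Fin n)) ℂ →ₐ[ℂ]
      MvPolynomial (Fin n × (Fin (k - 1) → Fin n)) ℂ :=
  aeval (signTwist ε (X : HyperTensor (MvPolynomial (Fin n × (Fin (k - 1) → Fin n)) ℂ) k n))

/-- A general algebra `S` is needed because the characteristic polynomial evaluates the determinant
in `ℂ[λ]`. -/
theorem aeval_signTwistHom {S : Type*} [CommRing S] [Algebra ℂ S] (T : HyperTensor S k n)
    (P : MvPolynomial (Fin n × (Fin (k - 1) → Fin n)) ℂ) :
    aeval T (signTwistHom k ε P) = aeval (signTwist ε T) P := by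
  have : (aeval T).comp (signTwistHom k ε) = aeval (signTwist ε T) := by
    apply algHom_ext
    intro p
    simp [signTwistHom, signTwist]
  exact DFunLike.congr_fun this P

theorem signTwistHom_signTwistHom (P : MvPolynomial (Fin n × (Fin (k - 1) → Fin n)) ℂ) :
    signTwistHom k ε (signTwistHom k ε P) = P := by
  -- `X` is the generic tensor: twisting it twice gives it back, and evaluation at it is the
  -- identity.
  have h := aeval_signTwistHom ε
    (signTwist ε (X : HyperTensor (MvPolynomial (Fin n × (Fin (k - 1) → Fin n)) ℂ) k n)) P
  rwa [signTwist_signTwist, aeval_X_left_apply] at h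

/-- The substitution is its own inverse, hence an automorphism of the polynomial ring. -/
theorem irreducible_signTwistHom {P : MvPolynomial (Fin n × (Fin (k - 1) → Fin n)) ℂ}
    (hP : Irreducible P) : Irreducible (signTwistHom k ε P) := by
  let e := AlgEquiv.ofAlgHom (signTwistHom k ε) (signTwistHom k ε)
    (AlgHom.ext (signTwistHom_signTwistHom ε)) (AlgHom.ext (signTwistHom_signTwistHom ε))
  exact (MulEquiv.irreducible_iff e.toMulEquiv).2 hP

/-- Evenness of `k` enters only in the normalization at the identity tensor. -/
theorem IsDeterminant.signTwistHom {D : MvPolynomial (Fin n × (Fin (k - 1) → Fin n)) ℂ}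
    (hD : IsDeterminant k n D) (hk : Even k) (hk0 : k ≠ 0) :
    IsDeterminant k n (signTwistHom k ε D) where
  irreducible := irreducible_signTwistHom ε hD.irreducible
  aeval_eq_zero_iff T := by
    rw [aeval_signTwistHom, hD.aeval_eq_zero_iff, isSingular_signTwist_iff]
  aeval_identity := by
    rw [aeval_signTwistHom, signTwist_identity ε hk hk0, hD.aeval_identity]

/-- For even order, the determinant is invariant under sign twists. -/
theorem aeval_signTwist_determinant {S : Type*} [CommRing S] [Algebra ℂ S]
    (hk : Even k) (hk0 : k ≠ 0) (hn : 0 < n) (T : HyperTensor S k n) :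
    aeval (signTwist ε T) (determinant k n) = aeval T (determinant k n) := by
  have hk2 : 2 ≤ k := by
    obtain ⟨m, rfl⟩ := hk
    omega
  have hD := isDeterminant_determinant hk2 hn
  -- Uniqueness gives an equality of polynomials, which can therefore be evaluated in any `S`.
  rw [← aeval_signTwistHom, (hD.signTwistHom ε hk hk0).unique hD]

/-! ### Invariance of the spectrum -/

theorem shift_signTwist {S : Type*} [CommRing S] [Algebra ℂ S] (hk : Even k) (hk0 : k ≠ 0)
    (lam : S) (T : HyperTensor ℝ k n) :
    shift lam (signTwist ε T) = signTwist ε (shift lam T) := by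
  funext p
  have h := congrFun (signTwist_identity (R := S) (n := n) ε hk hk0) p
  simp only [signTwist] at h
  simp only [shift, signTwist, mul_sub]
  -- The sign moves past `lam` onto the identity entry, which absorbs it.
  rw [mul_left_comm, h]
  simp

theorem spectrum_signTwist (hk : Even k) (hk0 : k ≠ 0) (hn : 0 < n) (T : HyperTensor ℝ k n) :
    (signTwist ε T).spectrum = T.spectrum := by
  have hchar : (signTwist ε T).charpoly = T.charpoly := by
    rw [charpoly, shift_signTwist ε hk hk0, aeval_signTwist_determinant ε hk hk0 hn, charpoly]
  have heig : ∀ lam, (signTwist ε T).IsEigenvalue lam ↔ T.IsEigenvalue lam := by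
    intro lam
    -- Being an eigenvalue is, by definition, singularity of the shifted tensor.
    change (shift lam (signTwist ε T)).IsSingular ↔ (shift lam T).IsSingular
    rw [shift_signTwist ε hk hk0, isSingular_signTwist_iff]
  simp only [spectrum, hchar, heig]

/-! ### The sign of an edge -/

open Classical in
/-- The sign vector that is `-1` exactly on `V₁`. -/
noncomputable def setSign (V₁ : Set (Fin n)) (i : Fin n) : ℤˣ := if i ∈ V₁ then -1 else 1

/-- The `k` indices take `k` distinct values, so the sign is a product over the vertices of the
edge, with a single factor `-1`. -/
theorem indexSign_setSign (hk0 : k ≠ 0) (V₁ : Set (Fin n))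
    (p : Fin n × (Fin (k - 1) → Fin n)) (hcard : (insert p.1 (Set.range p.2)).ncard = k)
    (hone : (insert p.1 (Set.range p.2) ∩ V₁).ncard = 1) :
    indexSign (setSign V₁) p = -1 := by
  classical
  -- All `k` index positions at once: `none` is the first, `some l` the others.
  let f : Option (Fin (k - 1)) → Fin n := fun o => o.elim p.1 p.2
  have hcoe : ((Finset.univ.image f : Finset (Fin n)) : Set (Fin n)) =
      insert p.1 (Set.range p.2) := by
    ext v
    simp [f, Option.exists, eq_comm]
  -- The image of `f` has `k` elements, as many as its domain.
  have hinj : Function.Injective f := by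
    rw [← Set.injOn_univ, ← Finset.coe_univ]
    refine Finset.card_image_iff.1 ?_
    rw [← Set.ncard_coe_finset, hcoe, hcard, Finset.card_univ, Fintype.card_option,
      Fintype.card_fin]
    omega
  have hprod : indexSign (setSign V₁) p = ∏ v ∈ Finset.univ.image f, setSign V₁ v := by
    rw [Finset.prod_image fun a _ b _ h => hinj h, Fintype.prod_option]
    rfl
  have hfilter : ((Finset.univ.image f).filter (· ∈ V₁)).card = 1 := by
    rw [← hcoe] at hone
    rw [← Set.ncard_coe_finset, Finset.coe_filter]
    exact hone
  rw [hprod]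
  simp only [setSign]
  rw [Finset.prod_ite, Finset.prod_const, Finset.prod_const_one, hfilter, pow_one, mul_one]

end HyperTensor

/-! ### The Laplacian and the signless Laplacian -/

namespace Hypergraph

open HyperTensor

/-- `A` is supported on the edges, where the sign is `-1`, and `D` on the diagonal, where it is `1`.
-/
theorem signTwist_laplacianTensor {k n : ℕ} (hk : Even k) (hk0 : k ≠ 0)
    {G : Hypergraph (Fin n)} (hG : G.IsUniformOn k) {V₁ : Set (Fin n)}
    (hV₁ : ∀ e ∈ G.edgeSet, (e ∩ V₁).ncard = 1) :
    signTwist (setSign V₁) (G.laplacianTensor k) = G.signlessLaplacianTensor k := by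
  funext p
  have hA : ((indexSign (setSign V₁) p : ℤ) : ℝ) * G.adjacencyTensor k p =
      -G.adjacencyTensor k p := by
    simp only [adjacencyTensor]
    split_ifs with h
    · simp [indexSign_setSign hk0 V₁ p (hG.ncard_edge _ h) (hV₁ _ h)]
    · simp
  have hD : ((indexSign (setSign V₁) p : ℤ) : ℝ) * G.degreeTensor k p = G.degreeTensor k p := by
    simp only [degreeTensor]
    split_ifs with h
    · simp [indexSign_of_forall_eq _ hk hk0 h]
    · simp
  simp only [signTwist, laplacianTensor, signlessLaplacianTensor, Pi.sub_apply, Pi.add_apply,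
    mul_sub, hA, hD, sub_neg_eq_add]

end Hypergraph

theorem proposition3p2 (k n : ℕ) (hk : 3 ≤ k) (hkn : k ≤ n) (heven : Even k)
    (G : Hypergraph (Fin n)) (hG : G.IsUniformOn k) (hbip : G.IsHmBipartite k) :
    (G.laplacianTensor k).spectrum = (G.signlessLaplacianTensor k).spectrum := by
  obtain ⟨V₁, hV₁⟩ : ∃ V₁ : Set (Fin n), ∀ e ∈ G.edgeSet, (e ∩ V₁).ncard = 1 := by
    rcases hbip with hE | ⟨V₁, _, _, _, _, _, hV⟩
    -- Without edges the condition is vacuous and any set would do.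
    · exact ⟨∅, by simp [hE]⟩
    · exact ⟨V₁, fun e he => (hV e he).1⟩
  rw [← Hypergraph.signTwist_laplacianTensor heven (by omega) hG hV₁,
    HyperTensor.spectrum_signTwist _ heven (by omega) (by omega)]
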